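/- **Theorem 2.1** (Orlov–Shcherbin, in the Goulden–Jackson form). Let $R$ be a commutative $\mathbb Q$-algebra (for instance $R=\mathbb C$, or $R=\mathbb C[y_c : c\in\mathbb Z]$ with indeterminates $y_c$), and let $y_c\in R$, $c\in\mathbb Z$, be arbitrary parameters. Then the formal power series $$\sum_\mu y_\mu\,\frac{\dim_\mu}{|\mu|!}\,s_\mu(p_1,p_2,\dots)\in R[[p_1,p_2,\dots]],$$ where $\mu$ runs over all partitions (including the empty one), is a $\tau$-function of the KP hierarchy. In other words, for arbitrary values of the parameters one obtains a family of KP $\tau$-functions. Here $y_\mu=\prod_{w\in\mu}y_{c(w)}$ is the product over the cells $w$ of the Young diagram of $\mu$, the content of the cell in row $i$ and column $j$ being $c(w)=j-i$; $\dim_\mu$ is the dimension of the irreducible complex representation of the symmetric group $S_{|\mu|}$ corresponding to $\mu$; $s_\mu=\det\|s_{\mu_j-j+i}\|_{1\le i,j\le \ell(\mu)}$ are the Schur polynomials, where $\ell(\mu)$ is the number of parts of $\mu$, $\sum_{n\ge0}s_nz^n=\exp\bigl(\sum_{k\ge1}p_kz^k/k\bigr)$ and $s_n=0$ for $n<0$.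 A series $\tau\in R[[p_1,p_2,\dots]]$ is called a $\tau$-function of the KP hierarchy if it corresponds to a point of the semi-infinite Grassmannian, that is, if there are Laurent series $\beta_1,\beta_2,\dots\in R((z))$, with $\beta_k=z^{-k}+(\text{higher powers of }z)$ for all sufficiently large $k$, such that the wedge product $$\beta_1\wedge\beta_2\wedge\beta_3\wedge\cdots=\sum_\mu F_\mu v_\mu,\qquad v_\mu=z^{\mu_1-1}\wedge z^{\mu_2-2}\wedge z^{\mu_3-3}\wedge\cdots,$$ is nonzero and $\tau=\sum_\mu F_\mu s_\mu$. The coefficient $F_\mu$ is the determinant $\det\|[z^{\mu_i-i}]\beta_k\|_{1\le i,k\le n}$ for all sufficiently large $n$, where $[z^m]\beta$ denotes the coefficient of $z^m$ in $\beta$. If $R$ is not a field, "nonzero" means that the coefficients $F_\mu$ generate the unit ideal of $R$. -/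

import Mathlib

noncomputable section

namespace KP

/-! ### Young diagrams: contents and dimensions

Partitions are Mathlib's `YoungDiagram`s; the cell `(i, j)` lies in row `i` and column `j`, both
counted from `0`, and `μ.rowLen i` is the part number `i + 1` of the partition. -/

/-- The content of a cell: its column number minus its row number. -/
def content (w : ℕ × ℕ) : ℤ := (w.2 : ℤ) - (w.1 : ℤ)

/-- The monomial `y_μ`, the product over the cells `w` of `μ` of the parameters `y_{c(w)}`. -/
def contentProduct {R : Type*} [CommRing R] (y : ℤ → R) (μ : YoungDiagram) : R :=
  ∏ w ∈ μ.cells, y (content w)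

/-- The symmetric group of degree `|μ|`, acting on the cells of `μ`. -/
abbrev CellPerm (μ : YoungDiagram) : Type := Equiv.Perm {w : ℕ × ℕ // w ∈ μ.cells}

/-- The Young symmetrizer of `μ` in the complex group algebra of the symmetric group: the sum of
the permutations preserving every row, times the signed sum of those preserving every column. -/
def youngSymmetrizer (μ : YoungDiagram) : MonoidAlgebra ℂ (CellPerm μ) :=
  (∑ σ : CellPerm μ with ∀ w, (σ w).1.1 = w.1.1, MonoidAlgebra.single σ (1 : ℂ)) *
  (∑ σ : CellPerm μ with ∀ w, (σ w).1.2 = w.1.2,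
    MonoidAlgebra.single σ (((Equiv.Perm.sign σ : ℤˣ) : ℤ) : ℂ))

/-- The irreducible complex representation of the symmetric group attached to `μ`: the left ideal
of the group algebra generated by the Young symmetrizer (the Specht module). -/
abbrev spechtModule (μ : YoungDiagram) : Ideal (MonoidAlgebra ℂ (CellPerm μ)) :=
  Ideal.span {youngSymmetrizer μ}

/-- `dim_μ`, the complex dimension of the irreducible representation attached to `μ`. -/
def spechtDim (μ : YoungDiagram) : ℕ := Module.finrank ℂ (spechtModule μ)

/-! ### Schur polynomials in the variables `p_1, p_2, …` -/

/-- The series `p_1 z + p_2 z^2 / 2 + p_3 z^3 / 3 + ⋯` in `z`. -/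
def powerSumSeries : PowerSeries (MvPolynomial ℕ+ ℚ) :=
  PowerSeries.mk fun n =>
    if hn : 0 < n then MvPolynomial.C (1 / (n : ℚ)) * MvPolynomial.X ⟨n, hn⟩ else 0

/-- The one-row Schur polynomials `s_n`, the coefficients of `z ^ n` in
`exp (p_1 z + p_2 z^2 / 2 + p_3 z^3 / 3 + ⋯)`; they are zero for negative `n`. -/
def schurRow (n : ℤ) : MvPolynomial ℕ+ ℚ :=
  if 0 ≤ n then
    PowerSeries.coeff n.toNat ((PowerSeries.exp ℚ).subst powerSumSeries : PowerSeries _)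
  else 0

/-- The Schur polynomial `s_μ = det (s_{μ_j - j + i})`, the size of the determinant being the
number of rows of `μ`. -/
def schur (μ : YoungDiagram) : MvPolynomial ℕ+ ℚ :=
  Matrix.det (Matrix.of fun i j : Fin (μ.colLen 0) =>
    schurRow ((μ.rowLen j : ℤ) - (j : ℕ) + (i : ℕ)))

/-! ### Infinite linear combinations of Schur polynomials -/

/-- The formal power series `∑_μ F_μ s_μ` in `p_1, p_2, …`. The sum is taken coefficientwise;
every coefficient is a finite sum, by `finite_support_coeff_schur` below. This is the
boson–fermion correspondence, applied to the (infinite) combination `∑_μ F_μ v_μ`. -/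
def schurSeries {R : Type*} [CommRing R] [Algebra ℚ R] (F : YoungDiagram → R) :
    MvPowerSeries ℕ+ R :=
  fun d => ∑ᶠ μ : YoungDiagram, F μ * algebraMap ℚ R (MvPolynomial.coeff d (schur μ))

/-! ### Semi-infinite planes and `τ`-functions -/

/-- The sequence `β_1, β_2, …` of Laurent series (here `β k` is `β_{k+1}`) is admissible if for all
large `k` the leading term of `β_k` is `z ^ (-k)`. -/
def IsAdmissible {R : Type*} [CommRing R] (β : ℕ → LaurentSeries R) : Prop :=
  ∃ N : ℕ, ∀ k ≥ N, (β k).coeff (-(k : ℤ) - 1) = 1 ∧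
    ∀ m : ℤ, m < -(k : ℤ) - 1 → (β k).coeff m = 0

/-- `∑_μ F_μ v_μ` is the expansion of `β_1 ∧ β_2 ∧ ⋯` in the basic vectors
`v_μ = z ^ (μ_1 - 1) ∧ z ^ (μ_2 - 2) ∧ ⋯`: the coefficient `F_μ` is the minor formed by the
coefficients of `z ^ (μ_i - i)` in `β_k`, for `1 ≤ i, k ≤ n`. For an admissible sequence this minor
does not depend on `n`, once `n` is large enough. -/
def IsWedgeExpansion {R : Type*} [CommRing R] (β : ℕ → LaurentSeries R) (F : YoungDiagram → R) :
    Prop :=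
  ∀ μ : YoungDiagram, ∃ N : ℕ, ∀ n ≥ N,
    Matrix.det (Matrix.of fun i k : Fin n =>
      (β k).coeff ((μ.rowLen i : ℤ) - (i : ℕ) - 1)) = F μ

/-- `τ` is a `τ`-function of the KP hierarchy: it corresponds, under `v_μ ↦ s_μ`, to a point
`β_1 ∧ β_2 ∧ ⋯` of the semi-infinite Grassmannian. That the wedge product is nonzero is expressed
by its coordinates generating the unit ideal: over a field, this says that some coordinate is not
zero, and over a ring, that the wedge product is nonzero for all specializations to a field.
The wedge product of a plane may be rescaled by rescaling `β_1`, so no extra factor is needed. -/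
def IsTauFunction {R : Type*} [CommRing R] [Algebra ℚ R] (τ : MvPowerSeries ℕ+ R) : Prop :=
  ∃ (β : ℕ → LaurentSeries R) (F : YoungDiagram → R),
    IsAdmissible β ∧ IsWedgeExpansion β F ∧ Ideal.span (Set.range F) = ⊤ ∧ τ = schurSeries F

/-! ### Coefficientwise finiteness of the sums over all diagrams -/

theorem powerSumSeries_constantCoeff : PowerSeries.constantCoeff powerSumSeries = 0 := by
  rw [← PowerSeries.coeff_zero_eq_constantCoeff_apply]
  simp [powerSumSeries]

theorem coeff_powerSumSeries_pow_homogeneous (m n : ℕ) :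
    MvPolynomial.IsWeightedHomogeneous (fun k : ℕ+ => (k : ℕ))
      (PowerSeries.coeff n (powerSumSeries ^ m)) n := by
  induction m generalizing n with
  | zero =>
    rw [pow_zero, PowerSeries.coeff_one]
    split_ifs with h
    · subst h; exact MvPolynomial.isWeightedHomogeneous_one _ _
    · exact MvPolynomial.isWeightedHomogeneous_zero _ _ _
  | succ m ih =>
    rw [pow_succ, PowerSeries.coeff_mul]
    refine MvPolynomial.IsWeightedHomogeneous.sum _ _ _ fun x hx => ?_
    rw [← Finset.HasAntidiagonal.mem_antidiagonal.mp hx]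
    refine (ih x.1).mul ?_
    rw [powerSumSeries, PowerSeries.coeff_mk]
    split_ifs with h
    · exact (MvPolynomial.isWeightedHomogeneous_X ℚ (fun k : ℕ+ => (k : ℕ)) ⟨x.2, h⟩).C_mul _
    · exact MvPolynomial.isWeightedHomogeneous_zero _ _ _

theorem schurRow_homogeneous (n : ℤ) :
    MvPolynomial.IsWeightedHomogeneous (fun k : ℕ+ => (k : ℕ)) (schurRow n) n.toNat := by
  rw [schurRow]
  split_ifs with h
  · rw [PowerSeries.coeff_subst'
      (PowerSeries.HasSubst.of_constantCoeff_zero' powerSumSeries_constantCoeff), finsum]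
    split_ifs with hf
    · refine MvPolynomial.IsWeightedHomogeneous.sum _ _ _ fun d _ => ?_
      rw [MvPolynomial.smul_eq_C_mul]
      exact (coeff_powerSumSeries_pow_homogeneous _ _).C_mul _
    · exact MvPolynomial.isWeightedHomogeneous_zero _ _ _
  · exact MvPolynomial.isWeightedHomogeneous_zero _ _ _

theorem card_eq_sum_rowLen (μ : YoungDiagram) :
    μ.card = ∑ i : Fin (μ.colLen 0), μ.rowLen i := by
  rw [Fin.sum_univ_eq_sum_range (fun i => μ.rowLen i), YoungDiagram.card,
    Finset.card_eq_sum_card_fiberwise (f := Prod.fst) (t := Finset.range (μ.colLen 0))]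
  · refine Finset.sum_congr rfl fun i _ => ?_
    rw [YoungDiagram.rowLen_eq_card, YoungDiagram.row]
  · rintro ⟨i, j⟩ hw
    simp only [Finset.coe_range, Set.mem_Iio]
    rw [← YoungDiagram.mem_iff_lt_colLen]
    exact μ.up_left_mem le_rfl (Nat.zero_le _) hw

/-- `s_μ` is quasihomogeneous of degree `|μ|`, the degree of `p_k` being `k`. -/
theorem schur_homogeneous (μ : YoungDiagram) :
    MvPolynomial.IsWeightedHomogeneous (fun k : ℕ+ => (k : ℕ)) (schur μ) μ.card := by
  rw [schur, Matrix.det_apply]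
  refine MvPolynomial.IsWeightedHomogeneous.sum _ _ _ fun σ _ => ?_
  rw [Units.smul_def, zsmul_eq_mul, ← map_intCast (MvPolynomial.C (σ := ℕ+) (R := ℚ))]
  refine MvPolynomial.IsWeightedHomogeneous.C_mul ?_ _
  simp only [Matrix.of_apply]
  by_cases hneg : ∃ j : Fin (μ.colLen 0), (μ.rowLen j : ℤ) - (j : ℕ) + (σ j : ℕ) < 0
  · obtain ⟨j, hj⟩ := hneg
    rw [Finset.prod_eq_zero (Finset.mem_univ j) (by rw [schurRow, if_neg (not_le.mpr hj)])]
    exact MvPolynomial.isWeightedHomogeneous_zero _ _ _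
  · push Not at hneg
    have h := MvPolynomial.IsWeightedHomogeneous.prod Finset.univ
      (fun j : Fin (μ.colLen 0) => schurRow ((μ.rowLen j : ℤ) - (j : ℕ) + (σ j : ℕ)))
      (fun j => ((μ.rowLen j : ℤ) - (j : ℕ) + (σ j : ℕ)).toNat)
      (fun j _ => schurRow_homogeneous _)
    convert h using 1
    zify
    rw [Finset.sum_congr rfl fun j _ => Int.toNat_of_nonneg (hneg j), Finset.sum_add_distrib,
      Finset.sum_sub_distrib, Equiv.sum_comp σ (fun j => ((j : ℕ) : ℤ)), card_eq_sum_rowLen]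
    push_cast
    ring

theorem finite_card_eq (n : ℕ) : {μ : YoungDiagram | μ.card = n}.Finite := by
  have hinj : Function.Injective YoungDiagram.cells := fun a b h => YoungDiagram.ext h
  refine Set.Finite.of_finite_image (f := YoungDiagram.cells) ?_ hinj.injOn
  refine (Finset.finite_toSet ((Finset.range n ×ˢ Finset.range n).powerset)).subset ?_
  rintro _ ⟨μ, hμ, rfl⟩
  simp only [Finset.coe_powerset, Set.mem_preimage, Set.mem_powerset_iff, Finset.coe_subset]
  rintro ⟨i, j⟩ hw
  have h1 : (Finset.range (i + 1) ×ˢ {0}) ⊆ μ.cells := by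
    rintro ⟨a, b⟩ hab
    simp only [Finset.mem_product, Finset.mem_range, Finset.mem_singleton] at hab
    exact μ.up_left_mem (by omega) (by omega) hw
  have h2 : ({0} ×ˢ Finset.range (j + 1)) ⊆ μ.cells := by
    rintro ⟨a, b⟩ hab
    simp only [Finset.mem_product, Finset.mem_range, Finset.mem_singleton] at hab
    exact μ.up_left_mem (by omega) (by omega) hw
  have h3 := Finset.card_le_card h1
  have h4 := Finset.card_le_card h2
  simp only [Finset.card_product, Finset.card_range, Finset.card_singleton] at h3 h4
  have h5 : μ.cells.card = n := hμ
  simp only [Finset.mem_product, Finset.mem_range]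
  omega

/-- Only finitely many Schur polynomials contain a given monomial. -/
theorem finite_support_coeff_schur {R : Type*} [CommRing R] [Algebra ℚ R]
    (F : YoungDiagram → R) (d : ℕ+ →₀ ℕ) :
    (Function.support fun μ : YoungDiagram =>
      F μ * algebraMap ℚ R (MvPolynomial.coeff d (schur μ))).Finite := by
  refine (finite_card_eq (Finsupp.weight (fun k : ℕ+ => (k : ℕ)) d)).subset fun μ hμ => ?_
  by_contra hne
  refine hμ ?_
  simp only
  rw [(schur_homogeneous μ).coeff_eq_zero d (fun h => hne h.symm)]
  simp

end KP

end

/-! If all y_c equal 1, the series is exp(p_1) and its plane is spanned by z^(-k) e^z. Rescaling the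
powers of z so that v_μ is multiplied by y_μ leads to β_k = ∑_m y_{-k+1} ⋯ y_m z^m / (m+k)!, which
involves no quotients of parameters and so makes sense for non-invertible y_c (`planeSeries`).

In the Leibniz expansion of the minor of this plane attached to μ, every nonzero term carries the
same product of parameters: intervals of contents with the same lower and upper endpoints have the
same union as multisets, however the endpoints are matched (`prod_contentRange_perm`). Hence the
minor is y_μ det(1/(μ_i - i + k)!) (`det_planeCoeff`). For the empty diagram it is 1, so the
coordinates generate the unit ideal.

It remains to identify the determinant with dim_μ / |μ|! (`spechtDim_div_factorial`). Let f_μ be the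
number of standard fillings. The determinant times |μ|! obeys the branching rule of f_μ, so the two
agree (`card_standardFillings`). A second determinantal identity, for adding a cell, gives ∑ f_μ² =
n! (`sum_card_standardFillings_sq`).

Young symmetrizers give f_μ ≤ dim_μ (`card_le_symmetrizerRank`), and independence of the left ideals
of all standard fillings gives ∑ f_μ dim_μ ≤ n! (`sum_symmetrizerRank_le`). Together, n! = ∑ f_μ² ≤
∑ f_μ dim_μ ≤ n!, and since f_μ > 0 this forces dim_μ = f_μ. -/

noncomputable section

namespace KP

/-! ### Signed subgroup sums and a Hermitian form on the group algebra -/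

section HermForm

variable {G : Type*} [Fintype G]

/-- The standard Hermitian form on the group algebra. -/
def hermForm (x y : MonoidAlgebra ℂ G) : ℂ := ∑ g, x.coeff g * (starRingEnd ℂ) (y.coeff g)

theorem hermForm_sum_left {ι : Type*} (s : Finset ι) (f : ι → MonoidAlgebra ℂ G)
    (y : MonoidAlgebra ℂ G) : hermForm (∑ i ∈ s, f i) y = ∑ i ∈ s, hermForm (f i) y := by
  simp only [hermForm, MonoidAlgebra.coeff_sum, Finsupp.finsetSum_apply, Finset.sum_mul]
  rw [Finset.sum_comm]

theorem hermForm_sum_right {ι : Type*} (s : Finset ι) (f : ι → MonoidAlgebra ℂ G)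
    (x : MonoidAlgebra ℂ G) : hermForm x (∑ i ∈ s, f i) = ∑ i ∈ s, hermForm x (f i) := by
  simp only [hermForm, MonoidAlgebra.coeff_sum, Finsupp.finsetSum_apply, map_sum, Finset.mul_sum]
  rw [Finset.sum_comm]

end HermForm

section CharSum

variable {G : Type*} [Group G] [Fintype G]

open Classical in
/-- The sum of the elements of a subgroup, weighted by a sign character. -/
def charSum (H : Subgroup G) (χ : G →* ℤˣ) : MonoidAlgebra ℂ G :=
  ∑ h : G with h ∈ H, MonoidAlgebra.single h (((χ h : ℤˣ) : ℤ) : ℂ)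

open Classical in
theorem coeff_charSum (H : Subgroup G) (χ : G →* ℤˣ) (g : G) :
    (charSum H χ).coeff g = if g ∈ H then (((χ g : ℤˣ) : ℤ) : ℂ) else 0 := by
  simp [charSum, MonoidAlgebra.coeff_sum, Finsupp.finsetSum_apply, Finsupp.single_apply]

theorem units_int_mul_self_complex (u : ℤˣ) : (((u : ℤˣ) : ℤ) : ℂ) * (((u : ℤˣ) : ℤ) : ℂ) = 1 := by
  rw [← Int.cast_mul, ← Units.val_mul, Int.units_mul_self]; simp

theorem single_mul_charSum {H : Subgroup G} (χ : G →* ℤˣ) {h : G} (hh : h ∈ H) :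
    MonoidAlgebra.single h (1 : ℂ) * charSum H χ = (((χ h : ℤˣ) : ℤ) : ℂ) • charSum H χ := by
  ext g
  rw [MonoidAlgebra.coeff_single_mul_apply, MonoidAlgebra.coeff_smul_apply, coeff_charSum,
    coeff_charSum]
  classical
  rw [if_congr (H.mul_mem_cancel_left (H.inv_mem hh)) rfl rfl]
  split_ifs <;> simp [Int.units_inv_eq_self]

theorem charSum_mul_single {H : Subgroup G} (χ : G →* ℤˣ) {h : G} (hh : h ∈ H) :
    charSum H χ * MonoidAlgebra.single h (1 : ℂ) = (((χ h : ℤˣ) : ℤ) : ℂ) • charSum H χ := by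
  ext g
  rw [MonoidAlgebra.coeff_mul_single_apply, MonoidAlgebra.coeff_smul_apply, coeff_charSum,
    coeff_charSum]
  classical
  rw [if_congr (H.mul_mem_cancel_right (H.inv_mem hh)) rfl rfl]
  split_ifs <;> simp [Int.units_inv_eq_self, mul_comm]

theorem charSum_mul_self (H : Subgroup G) (χ : G →* ℤˣ) :
    charSum H χ * charSum H χ = (Nat.card H : ℂ) • charSum H χ := by
  classical
  conv_lhs => enter [1]; rw [charSum]
  rw [Finset.sum_mul, Finset.sum_congr rfl (g := fun _ => charSum H χ)]
  · rw [Finset.sum_const, Nat.card_eq_fintype_card, Fintype.card_subtype, Nat.cast_smul_eq_nsmul]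
  · intro h hh
    have hh : h ∈ H := (Finset.mem_filter.mp hh).2
    rw [← mul_one (((χ h : ℤˣ) : ℤ) : ℂ), ← MonoidAlgebra.smul_single', smul_mul_assoc,
      single_mul_charSum χ hh, smul_smul, units_int_mul_self_complex, one_smul]

theorem single_mul_charSum_conj {H H' : Subgroup G} (χ : G →* ℤˣ) (g : G)
    (hH : ∀ h, g * h * g⁻¹ ∈ H' ↔ h ∈ H) :
    MonoidAlgebra.single g (1 : ℂ) * charSum H χ =
      charSum H' χ * MonoidAlgebra.single g (1 : ℂ) := by
  ext x
  rw [MonoidAlgebra.coeff_single_mul_apply, MonoidAlgebra.coeff_mul_single_apply, coeff_charSum,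
    coeff_charSum]
  have : g * (g⁻¹ * x) * g⁻¹ = x * g⁻¹ := by group
  have h : g⁻¹ * x ∈ H ↔ x * g⁻¹ ∈ H' := by rw [← hH, this]
  classical
  rw [if_congr h rfl rfl]
  simp [mul_comm]

/-- The coefficient at `1` of a product of two character sums on disjoint subgroups. -/
theorem coeff_one_charSum_mul_charSum {H K : Subgroup G} (χ ψ : G →* ℤˣ)
    (hHK : ∀ g, g ∈ H → g ∈ K → g = 1) : (charSum H χ * charSum K ψ).coeff 1 = 1 := by
  classical
  rw [charSum, Finset.sum_mul, MonoidAlgebra.coeff_sum, Finsupp.finsetSum_apply,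
    Finset.sum_eq_single 1]
  · simp [MonoidAlgebra.coeff_single_mul_apply, coeff_charSum, K.one_mem]
  · intro h hh hne
    rw [MonoidAlgebra.coeff_single_mul_apply, coeff_charSum, if_neg, mul_zero]
    intro hK
    rw [mul_one] at hK
    exact hne (hHK h (Finset.mem_filter.mp hh).2 (K.inv_mem_iff.mp hK))
  · intro h
    exact absurd (Finset.mem_filter.mpr ⟨Finset.mem_univ _, H.one_mem⟩) h

/-- Two character sums annihilate each other if the characters differ in sign somewhere. -/
theorem charSum_mul_charSum_eq_zero {H K : Subgroup G} (χ ψ : G →* ℤˣ) {t : G} (htH : t ∈ H)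
    (htK : t ∈ K) (hχ : χ t = -1) (hψ : ψ t = 1) : charSum H χ * charSum K ψ = 0 := by
  have h1 := charSum_mul_single χ htH
  have h2 := single_mul_charSum ψ htK
  rw [hχ] at h1
  rw [hψ] at h2
  simp only [Units.val_neg, Units.val_one, Int.cast_neg, Int.cast_one, neg_smul, one_smul] at h1 h2
  -- Insert t between the factors: it acts by -1 on the left one and by 1 on the right one.
  have h3 : charSum H χ * charSum K ψ = -(charSum H χ * charSum K ψ) := by
    conv_lhs => rw [← h2, ← mul_assoc, h1, neg_mul]
  have h4 : (2 : ℂ) • (charSum H χ * charSum K ψ) = 0 := by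
    rw [two_smul]
    nth_rewrite 1 [h3]
    exact neg_add_cancel _
  exact (smul_eq_zero.mp h4).resolve_left two_ne_zero

theorem hermForm_self_eq_zero {x : MonoidAlgebra ℂ G} (h : hermForm x x = 0) : x = 0 := by
  have h' : ((∑ g, Complex.normSq (x.coeff g) : ℝ) : ℂ) = 0 := by
    rw [← h, hermForm, Complex.ofReal_sum]
    exact Finset.sum_congr rfl fun g _ => (Complex.mul_conj _).symm
  rw [Complex.ofReal_eq_zero, Finset.sum_eq_zero_iff_of_nonneg
    fun g _ => Complex.normSq_nonneg _] at h'
  ext g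
  simpa using h' g (Finset.mem_univ g)

theorem hermForm_mul_single (x y : MonoidAlgebra ℂ G) (h : G) (m : ℤ) :
    hermForm (x * MonoidAlgebra.single h (m : ℂ)) y =
      hermForm x (y * MonoidAlgebra.single h⁻¹ (m : ℂ)) := by
  rw [hermForm, hermForm, ← Equiv.sum_comp (Equiv.mulRight h)]
  refine Finset.sum_congr rfl fun g _ => ?_
  simp only [MonoidAlgebra.coeff_mul_single_apply, Equiv.coe_mulRight, mul_inv_cancel_right,
    inv_inv, map_mul, map_intCast]
  ring

/-- The adjoint of right multiplication by h is right multiplication by h⁻¹, and inversion permutes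
H and preserves the sign χ. -/
theorem hermForm_mul_charSum (H : Subgroup G) (χ : G →* ℤˣ) (x y : MonoidAlgebra ℂ G) :
    hermForm (x * charSum H χ) y = hermForm x (y * charSum H χ) := by
  classical
  rw [charSum, Finset.mul_sum, Finset.mul_sum, hermForm_sum_left, hermForm_sum_right]
  refine Finset.sum_bij' (fun h _ => h⁻¹) (fun h _ => h⁻¹) ?_ ?_ ?_ ?_ ?_
  · simp
  · simp
  · simp
  · simp
  · intro h _
    rw [hermForm_mul_single, map_inv, Int.units_inv_eq_self]

/-- Write a, b for the two sums. Both are self-adjoint and b² is a multiple of b, so ⟨xab, xab⟩ is a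
multiple of ⟨xab, xa⟩ = ⟨xaba, x⟩ = 0, and the form is positive definite. -/
theorem mul_charSum_mul_charSum_eq_zero {H K : Subgroup G} (χ ψ : G →* ℤˣ)
    {x : MonoidAlgebra ℂ G} (h : x * charSum H χ * charSum K ψ * charSum H χ = 0) :
    x * charSum H χ * charSum K ψ = 0 := by
  apply hermForm_self_eq_zero
  rw [← hermForm_mul_charSum, mul_assoc (x * charSum H χ), charSum_mul_self, mul_smul_comm,
    ← hermForm_mul_charSum, smul_mul_assoc, h, smul_zero]
  simp [hermForm]

end CharSum

/-! ### Row and column stabilizers, Young symmetrizers and their left ideals -/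

section FiberStabilizer

variable {α : Type*}

/-- The permutations preserving the fibres of a map. -/
def fiberStabilizer {γ : Type*} (f : α → γ) : Subgroup (Equiv.Perm α) where
  carrier := {σ | ∀ a, f (σ a) = f a}
  one_mem' _ := rfl
  mul_mem' {σ τ} hσ hτ a := by rw [Equiv.Perm.mul_apply, hσ, hτ]
  inv_mem' {σ} hσ a := by
    have h := hσ (σ⁻¹ a)
    rw [← Equiv.Perm.mul_apply, mul_inv_cancel] at h
    exact h.symm

theorem mem_fiberStabilizer {γ : Type*} {f : α → γ} {σ : Equiv.Perm α} :
    σ ∈ fiberStabilizer f ↔ ∀ a, f (σ a) = f a := Iff.rfl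

theorem conj_mem_fiberStabilizer {γ : Type*} {f f' : α → γ} {g : Equiv.Perm α}
    (h : ∀ a, f' (g a) = f a) (σ : Equiv.Perm α) :
    g * σ * g⁻¹ ∈ fiberStabilizer f' ↔ σ ∈ fiberStabilizer f := by
  rw [mem_fiberStabilizer, mem_fiberStabilizer]
  constructor
  · intro hσ a
    have := hσ (g a)
    simpa [h] using this
  · intro hσ a
    obtain ⟨b, rfl⟩ := g.surjective a
    simp [h, hσ]

theorem eq_one_of_mem_fiberStabilizer {T : α → ℕ × ℕ} (hT : Function.Injective T)
    {g : Equiv.Perm α} (h1 : g ∈ fiberStabilizer fun a => (T a).1)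
    (h2 : g ∈ fiberStabilizer fun a => (T a).2) : g = 1 := by
  exact Equiv.ext fun a => hT (Prod.ext (h1 a) (h2 a))

end FiberStabilizer

section Tableau

variable {α β : Type*} [Fintype α] [DecidableEq α] [Fintype β] [DecidableEq β]

/-- The row symmetrizer of a filling. -/
def rowSum (T : α → ℕ × ℕ) : MonoidAlgebra ℂ (Equiv.Perm α) :=
  charSum (fiberStabilizer fun a => (T a).1) 1

/-- The column antisymmetrizer of a filling. -/
def colSum (T : α → ℕ × ℕ) : MonoidAlgebra ℂ (Equiv.Perm α) :=
  charSum (fiberStabilizer fun a => (T a).2) Equiv.Perm.sign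

/-- The Young symmetrizer of a filling. -/
def symmetrizer (T : α → ℕ × ℕ) : MonoidAlgebra ℂ (Equiv.Perm α) := rowSum T * colSum T

/-- The transposition of i and j is odd in the column group of T and lies in the row group of S. -/
theorem colSum_mul_rowSum_eq_zero {S T : α → ℕ × ℕ} {i j : α} (hij : i ≠ j)
    (hT : (T i).2 = (T j).2) (hS : (S i).1 = (S j).1) : colSum T * rowSum S = 0 := by
  have key : ∀ (f : α → ℕ), f i = f j → Equiv.swap i j ∈ fiberStabilizer f := by
    intro f hf a
    rw [Equiv.swap_apply_def]
    split_ifs with h1 h2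
    · rw [h1, hf]
    · rw [h2, hf]
    · rfl
  exact charSum_mul_charSum_eq_zero _ _ (key _ hT) (key _ hS) (Equiv.Perm.sign_swap hij) rfl

theorem mul_symmetrizer_eq_zero {T : α → ℕ × ℕ} {x : MonoidAlgebra ℂ (Equiv.Perm α)}
    (h : x * symmetrizer T * rowSum T = 0) : x * symmetrizer T = 0 := by
  rw [symmetrizer, ← mul_assoc] at h ⊢
  exact mul_charSum_mul_charSum_eq_zero _ _ h

/-- By positivity, vanishing of column · row · column would make column · row vanish, but the latter
has coefficient 1 at the identity. -/
theorem colSum_mul_symmetrizer_ne_zero {T : α → ℕ × ℕ} (hT : Function.Injective T) :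
    colSum T * symmetrizer T ≠ 0 := by
  intro h
  have h1 : (1 : MonoidAlgebra ℂ (Equiv.Perm α)) * colSum T * rowSum T = 0 := by
    apply mul_charSum_mul_charSum_eq_zero
    rw [one_mul, mul_assoc]
    exact h
  have h2 : (colSum T * rowSum T).coeff 1 = 1 :=
    coeff_one_charSum_mul_charSum _ _ fun g h1 h2 => eq_one_of_mem_fiberStabilizer hT h2 h1
  rw [one_mul] at h1
  rw [h1] at h2
  simp at h2

theorem single_mul_symmetrizer {S T : α → ℕ × ℕ} {g : Equiv.Perm α} (h : ∀ a, S (g a) = T a) :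
    MonoidAlgebra.single g (1 : ℂ) * symmetrizer T =
      symmetrizer S * MonoidAlgebra.single g (1 : ℂ) := by
  rw [symmetrizer, symmetrizer, ← mul_assoc, rowSum, colSum,
    single_mul_charSum_conj 1 g (conj_mem_fiberStabilizer (f' := fun a => (S a).1)
      fun a => by rw [h]), mul_assoc,
    single_mul_charSum_conj _ g (conj_mem_fiberStabilizer (f' := fun a => (S a).2)
      fun a => by rw [h]), ← mul_assoc]
  rfl

/-- The dimension of the left ideal generated by the Young symmetrizer of a filling. -/
def symmetrizerRank (T : α → ℕ × ℕ) : ℕ :=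
  Module.finrank ℂ (LinearMap.range (LinearMap.mulRight ℂ (symmetrizer T)))

theorem domCongr_charSum (e : α ≃ β) {γ : Type*} (f : β → γ) (χ : Equiv.Perm α →* ℤˣ)
    (ψ : Equiv.Perm β →* ℤˣ) (h : ∀ σ, ψ (e.permCongr σ) = χ σ) :
    MonoidAlgebra.domCongr ℂ ℂ e.permCongrHom (charSum (fiberStabilizer (f ∘ e)) χ) =
      charSum (fiberStabilizer f) ψ := by
  classical
  rw [charSum, charSum, map_sum]
  refine Finset.sum_bij' (fun σ _ => e.permCongr σ) (fun σ _ => e.permCongr.symm σ)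
    ?_ ?_ ?_ ?_ ?_
  · intro σ hσ
    simp only [Finset.mem_filter, Finset.mem_univ, true_and, mem_fiberStabilizer,
      Function.comp_apply] at hσ ⊢
    intro a
    simpa using hσ (e.symm a)
  · intro σ hσ
    simp only [Finset.mem_filter, Finset.mem_univ, true_and, mem_fiberStabilizer,
      Function.comp_apply] at hσ ⊢
    intro a
    simpa using hσ (e a)
  · exact fun σ _ => e.permCongr.symm_apply_apply σ
  · exact fun σ _ => e.permCongr.apply_symm_apply σ
  · intro σ _
    rw [h]
    simp

theorem domCongr_symmetrizer (e : α ≃ β) (T : β → ℕ × ℕ) :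
    MonoidAlgebra.domCongr ℂ ℂ e.permCongrHom (symmetrizer (T ∘ e)) = symmetrizer T := by
  rw [symmetrizer, symmetrizer, map_mul]
  congr 1
  · exact domCongr_charSum e (fun b => (T b).1) 1 1 fun _ => rfl
  · exact domCongr_charSum e (fun b => (T b).2) _ _ fun σ => Equiv.Perm.sign_permCongr e σ

theorem symmetrizerRank_comp (e : α ≃ β) (T : β → ℕ × ℕ) :
    symmetrizerRank (T ∘ e) = symmetrizerRank T := by
  rw [symmetrizerRank, symmetrizerRank, ← domCongr_symmetrizer e T,
    ← LinearEquiv.finrank_map_eq (MonoidAlgebra.domCongr ℂ ℂ e.permCongrHom).toLinearEquiv]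
  suffices h : Submodule.map (MonoidAlgebra.domCongr ℂ ℂ e.permCongrHom).toLinearEquiv.toLinearMap
      (LinearMap.range (LinearMap.mulRight ℂ (symmetrizer (T ∘ e)))) = LinearMap.range
        (LinearMap.mulRight ℂ (MonoidAlgebra.domCongr ℂ ℂ e.permCongrHom (symmetrizer (T ∘ e)))) by
    rw [← h]
  ext x
  simp only [Submodule.mem_map, LinearMap.mem_range, LinearMap.mulRight_apply]
  constructor
  · rintro ⟨_, ⟨z, rfl⟩, rfl⟩
    exact ⟨MonoidAlgebra.domCongr ℂ ℂ e.permCongrHom z, by simp⟩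
  · rintro ⟨z, rfl⟩
    exact ⟨_, ⟨(MonoidAlgebra.domCongr ℂ ℂ e.permCongrHom).symm z, rfl⟩, by
      rw [AlgEquiv.toLinearEquiv_toLinearMap, AlgEquiv.toLinearMap_apply, map_mul,
        AlgEquiv.apply_symm_apply]⟩

theorem youngSymmetrizer_eq (μ : YoungDiagram) :
    youngSymmetrizer μ = symmetrizer (Subtype.val : {w : ℕ × ℕ // w ∈ μ.cells} → ℕ × ℕ) := by
  classical
  rw [youngSymmetrizer, symmetrizer, rowSum, colSum, charSum, charSum]
  congr 1
  · refine Finset.sum_congr ?_ fun σ _ => by simp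
    ext σ
    simp [mem_fiberStabilizer]
  · refine Finset.sum_congr ?_ fun σ _ => rfl
    ext σ
    simp [mem_fiberStabilizer]

theorem spechtDim_eq (μ : YoungDiagram) :
    spechtDim μ = symmetrizerRank (Subtype.val : {w : ℕ × ℕ // w ∈ μ.cells} → ℕ × ℕ) := by
  have h : LinearMap.range (LinearMap.mulRight ℂ (youngSymmetrizer μ)) =
      (spechtModule μ).restrictScalars ℂ := by
    ext x
    simp [Ideal.mem_span_singleton']
  rw [symmetrizerRank, ← youngSymmetrizer_eq, h]
  rfl

/-- Any filling of the cells of `μ` computes the dimension of the Specht module. -/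
theorem symmetrizerRank_eq_spechtDim {μ : YoungDiagram} {T : α → ℕ × ℕ}
    (hT : Function.Injective T) (hμ : Set.range T = μ.cells) :
    symmetrizerRank T = spechtDim μ := by
  have hmem : ∀ a, T a ∈ μ.cells := fun a => by
    rw [← Finset.mem_coe, ← hμ]; exact Set.mem_range_self a
  let e : α ≃ {w : ℕ × ℕ // w ∈ μ.cells} := Equiv.ofBijective (fun a => ⟨T a, hmem a⟩)
    ⟨fun a b h => hT (congrArg Subtype.val h), fun w => by
      have hw : (w : ℕ × ℕ) ∈ Set.range T := by rw [hμ]; exact w.2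
      obtain ⟨a, ha⟩ := hw
      exact ⟨a, Subtype.ext ha⟩⟩
  rw [spechtDim_eq, ← symmetrizerRank_comp e]
  rfl

end Tableau

/-! ### Standard fillings and independence of their symmetrizers -/

section Standard

variable {n : ℕ}

/-- Standard fillings: the entries are distinct, and every cell weakly to the north-west of the
cell with entry `k` carries an entry that is at most `k`. -/
structure IsStandard (T : Fin n → ℕ × ℕ) : Prop where
  injective : Function.Injective T
  exists_le : ∀ k w, w ≤ T k → ∃ j ≤ k, T j = w

/-- The sequence of the columns of the entries, ordered lexicographically. -/
def colWord (T : Fin n → ℕ × ℕ) : Lex (Fin n → ℕ) := toLex fun i => (T i).2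

/-- If T put j strictly higher in the same column, S would need an earlier entry in that cell; T has
the same entry there, contradicting injectivity. -/
theorem IsStandard.row_le {S T : Fin n → ℕ × ℕ} (hT : IsStandard T) (hS : IsStandard S) {j : Fin n}
    (h : ∀ i < j, T i = S i) (hj : (T j).2 = (S j).2) : (S j).1 ≤ (T j).1 := by
  by_contra! hlt
  obtain ⟨i, hi, hSi⟩ := hS.exists_le j (T j) (Prod.le_def.mpr ⟨hlt.le, hj.le⟩)
  rcases hi.lt_or_eq with hi' | rfl
  · exact hi'.ne (hT.injective ((h i hi').trans hSi))
  · rw [hSi] at hlt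
    exact hlt.false

/-- A standard filling is determined by the columns of its entries. -/
theorem IsStandard.eq_of_col_eq {S T : Fin n → ℕ × ℕ} (hT : IsStandard T) (hS : IsStandard S)
    {j : Fin n} (h : ∀ i ≤ j, (T i).2 = (S i).2) : T j = S j := by
  induction j using WellFoundedLT.induction with
  | ind j ih =>
    have h' : ∀ i < j, T i = S i := fun i hi => ih i hi fun k hk => h k (hk.trans hi.le)
    exact Prod.ext (le_antisymm (hS.row_le hT (fun i hi => (h' i hi).symm) (h j le_rfl).symm)
      (hT.row_le hS h' (h j le_rfl))) (h j le_rfl)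

theorem IsStandard.colWord_inj {S T : Fin n → ℕ × ℕ} (hT : IsStandard T) (hS : IsStandard S)
    (h : colWord T = colWord S) : T = S :=
  funext fun _ => hT.eq_of_col_eq hS fun i _ => congrFun (toLex.injective h) i

/-- At the first entry e whose columns differ, look at the cell of S in the row of `S e` and the
column of `T e`. Its entry i precedes e and has the same position in T, so i and e share a row of S
and a column of T. -/
theorem IsStandard.colSum_mul_rowSum_eq_zero {S T : Fin n → ℕ × ℕ} (hT : IsStandard T)
    (hS : IsStandard S) (h : colWord T < colWord S) : colSum T * rowSum S = 0 := by
  obtain ⟨e, heq, hlt⟩ := h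
  have hlt : (T e).2 < (S e).2 := hlt
  obtain ⟨i, hi, hSi⟩ := hS.exists_le e ((S e).1, (T e).2) (Prod.le_def.mpr ⟨le_rfl, hlt.le⟩)
  rcases hi.lt_or_eq with hi' | rfl
  · have hTi : T i = S i := hT.eq_of_col_eq hS fun k hk => heq k (hk.trans_lt hi')
    exact KP.colSum_mul_rowSum_eq_zero hi'.ne (by rw [hTi, hSi]) (by rw [hSi])
  · rw [hSi] at hlt
    exact absurd hlt (lt_irrefl _)

/-- The left ideals generated by the Young symmetrizers of the standard fillings, of all shapes,
are independent. -/
theorem sum_symmetrizerRank_le (J : Finset (Fin n → ℕ × ℕ)) (hJ : ∀ T ∈ J, IsStandard T) :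
    ∑ T ∈ J, symmetrizerRank T ≤ n.factorial := by
  let V : J → Submodule ℂ (MonoidAlgebra ℂ (Equiv.Perm (Fin n))) := fun T =>
    LinearMap.range (LinearMap.mulRight ℂ (symmetrizer T.1))
  let Φ : (∀ T, V T) →ₗ[ℂ] MonoidAlgebra ℂ (Equiv.Perm (Fin n)) :=
    ∑ T, (V T).subtype ∘ₗ LinearMap.proj T
  have hΦ : Function.Injective Φ := by
    rw [← LinearMap.ker_eq_bot, LinearMap.ker_eq_bot']
    intro v hv
    have hv : ∑ T, (v T : MonoidAlgebra ℂ (Equiv.Perm (Fin n))) = 0 := by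
      simpa [Φ, LinearMap.sum_apply] using hv
    by_contra hne
    have hs : (Finset.univ.filter fun T => v T ≠ 0).Nonempty := by
      obtain ⟨T, hT⟩ := Function.ne_iff.mp hne
      exact ⟨T, by simpa using hT⟩
    -- Right multiplication by `rowSum S` kills the components with smaller column word, so the
    -- largest one is isolated.
    obtain ⟨S, hS, hmax⟩ := Finset.exists_max_image _ (fun T : J => colWord T.1) hs
    have hS : v S ≠ 0 := by simpa using hS
    apply hS
    have hmul := congrArg (· * rowSum S.1) hv
    simp only [Finset.sum_mul, zero_mul] at hmul
    rw [Finset.sum_eq_single S ?_ (by simp)] at hmul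
    · obtain ⟨u, hu⟩ := (v S).2
      ext1
      rw [LinearMap.mulRight_apply] at hu
      rw [← hu] at hmul ⊢
      exact mul_symmetrizer_eq_zero hmul
    · intro T _ hTS
      by_cases hT : v T = 0
      · rw [hT]; simp
      · have hle := hmax T (by simpa using hT)
        have hlt : colWord T.1 < colWord S.1 := hle.lt_of_ne fun h =>
          hTS (Subtype.ext ((hJ _ T.2).colWord_inj (hJ _ S.2) h))
        obtain ⟨u, hu⟩ := (v T).2
        rw [LinearMap.mulRight_apply] at hu
        rw [← hu, symmetrizer, mul_assoc, mul_assoc,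
          (hJ _ T.2).colSum_mul_rowSum_eq_zero (hJ _ S.2) hlt, mul_zero, mul_zero]
  have hfin := LinearMap.finrank_le_finrank_of_injective hΦ
  rw [Module.finrank_pi_fintype] at hfin
  rw [← Finset.sum_coe_sort]
  refine hfin.trans (le_of_eq ?_)
  rw [(MonoidAlgebra.coeffLinearEquiv ℂ).finrank_eq, Module.finrank_finsupp_self, Fintype.card_perm,
    Fintype.card_fin]

/-- The translated Young symmetrizers of the standard fillings of a fixed shape are linearly
independent. -/
theorem card_le_symmetrizerRank {T₀ : Fin n → ℕ × ℕ} (hT₀ : Function.Injective T₀)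
    (J : Finset (Fin n → ℕ × ℕ)) (hJ : ∀ T ∈ J, IsStandard T)
    (hr : ∀ T ∈ J, Set.range T = Set.range T₀) : J.card ≤ symmetrizerRank T₀ := by
  have hex : ∀ T : J, ∃ g : Equiv.Perm (Fin n), ∀ a, T.1 (g a) = T₀ a := by
    intro T
    have h : ∀ a, ∃ b, T.1 b = T₀ a := fun a => by
      have : T₀ a ∈ Set.range T.1 := by rw [hr _ T.2]; exact Set.mem_range_self a
      exact this
    choose g hg using h
    have hinj : Function.Injective g := fun a b hab => hT₀ (by rw [← hg a, ← hg b, hab])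
    exact ⟨Equiv.ofBijective g (Finite.injective_iff_bijective.mp hinj), hg⟩
  choose g hg using hex
  let x : J → LinearMap.range (LinearMap.mulRight ℂ (symmetrizer T₀)) := fun T =>
    ⟨symmetrizer T.1 * MonoidAlgebra.single (g T) 1, MonoidAlgebra.single (g T) 1, by
      rw [LinearMap.mulRight_apply, single_mul_symmetrizer (hg T)]⟩
  have hx : LinearIndependent ℂ x := by
    rw [Fintype.linearIndependent_iff]
    intro c hc
    by_contra! hne
    have hs : (Finset.univ.filter fun T => c T ≠ 0).Nonempty := by
      obtain ⟨T, hT⟩ := hne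
      exact ⟨T, by simpa using hT⟩
    -- Here the multiplication is on the left, by `colSum T`, which kills the terms with larger
    -- column word; so the smallest one is isolated.
    obtain ⟨T, hT, hmin⟩ := Finset.exists_min_image _ (fun T : J => colWord T.1) hs
    have hT : c T ≠ 0 := by simpa using hT
    have hmul := congrArg (fun v : LinearMap.range (LinearMap.mulRight ℂ (symmetrizer T₀)) =>
      colSum T.1 * (v : MonoidAlgebra ℂ (Equiv.Perm (Fin n)))) hc
    simp only [Submodule.coe_sum, Finset.mul_sum, Submodule.coe_smul, Submodule.coe_zero, mul_zero,
      mul_smul_comm] at hmul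
    rw [Finset.sum_eq_single T ?_ (by simp)] at hmul
    · refine colSum_mul_symmetrizer_ne_zero (hJ _ T.2).injective ?_
      have h0 := (smul_eq_zero.mp hmul).resolve_left hT
      have h1 := congrArg (· * MonoidAlgebra.single (g T)⁻¹ (1 : ℂ)) h0
      simpa [x, mul_assoc, MonoidAlgebra.single_mul_single, ← MonoidAlgebra.one_def] using h1
    · intro S _ hST
      by_cases hS : c S = 0
      · rw [hS, zero_smul]
      · have hle := hmin S (by simpa using hS)
        have hlt : colWord T.1 < colWord S.1 := hle.lt_of_ne fun h =>
          hST (Subtype.ext ((hJ _ T.2).colWord_inj (hJ _ S.2) h)).symm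
        simp only [x, symmetrizer]
        rw [← mul_assoc, ← mul_assoc, (hJ _ T.2).colSum_mul_rowSum_eq_zero (hJ _ S.2) hlt,
          zero_mul, zero_mul, smul_zero]
  have := hx.fintype_card_le_finrank
  rwa [Fintype.card_coe] at this

end Standard

/-! ### Determinants of reciprocal factorials -/

section InvFact

/-- The reciprocal of the factorial, extended by zero to the negative integers. -/
def invFact (m : ℤ) : ℚ := if 0 ≤ m then 1 / (m.toNat.factorial : ℚ) else 0

theorem invFact_of_neg {m : ℤ} (h : m < 0) : invFact m = 0 := if_neg (not_le.mpr h)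

theorem invFact_zero : invFact 0 = 1 := by simp [invFact]

theorem invFact_sub_one (m : ℤ) : invFact (m - 1) = m * invFact m := by
  rcases lt_trichotomy m 0 with h | rfl | h
  · rw [invFact_of_neg h, invFact_of_neg (by omega), mul_zero]
  · rw [invFact_of_neg (by omega), Int.cast_zero, zero_mul]
  · obtain ⟨k, rfl⟩ : ∃ k : ℕ, m = k + 1 := ⟨(m - 1).toNat, by omega⟩
    have h1 : ((k : ℤ) + 1 - 1).toNat = k := by omega
    have h2 : ((k : ℤ) + 1).toNat = k + 1 := by omega
    rw [invFact, invFact, if_pos (by omega), if_pos (by omega), h1, h2, Nat.factorial_succ]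
    push_cast
    field_simp

/-- Replacing one row at a time by the row of a second matrix, or one column at a time by
its column, gives the same sum of determinants. -/
theorem sum_det_updateRow_eq_sum_det_updateCol {ι R : Type*} [Fintype ι] [DecidableEq ι]
    [CommRing R] (M : Matrix ι ι R)
    (f : ι → ι → R) :
    ∑ i, (M.updateRow i (f i)).det = ∑ j, (M.updateCol j fun i => f i j).det := by
  simp only [Matrix.det_apply]
  rw [Finset.sum_comm, Finset.sum_comm (s := Finset.univ (α := ι))]
  refine Finset.sum_congr rfl fun σ _ => ?_
  rw [← Equiv.sum_comp σ]
  refine Finset.sum_congr rfl fun j _ => congrArg _ (Finset.prod_congr rfl fun k _ => ?_)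
  rw [Matrix.updateRow_apply, Matrix.updateCol_apply, if_congr σ.injective.eq_iff rfl rfl]
  split_ifs with h
  · rw [h]
  · rfl

/-- The matrix with the entries `1 / (x_i + k)!`. -/
def factMatrix (N : ℕ) (x : ℕ → ℤ) : Matrix (Fin N) (Fin N) ℚ :=
  Matrix.of fun i k => invFact (x i + (k : ℕ))

theorem factMatrix_add_single {N : ℕ} (x : ℕ → ℤ) (i : Fin N) (c : ℤ) :
    factMatrix N (x + Pi.single (i : ℕ) c) =
      (factMatrix N x).updateRow i fun k => invFact (x i + c + (k : ℕ)) := by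
  ext a k
  rw [Matrix.updateRow_apply]
  split_ifs with h
  · subst h; simp [factMatrix]
  · have : (a : ℕ) ≠ i := fun h' => h (Fin.ext h')
    simp [factMatrix, this]

theorem det_factMatrix_eq_zero_of_eq {N : ℕ} {x : ℕ → ℤ} {i j : ℕ} (hi : i < N) (hj : j < N)
    (hij : i ≠ j) (h : x i = x j) : (factMatrix N x).det = 0 :=
  Matrix.det_zero_of_row_eq (i := ⟨i, hi⟩) (j := ⟨j, hj⟩) (fun h => hij (congrArg Fin.val h)) <| by
    ext k
    simp [factMatrix, h]

theorem det_factMatrix_eq_zero_of_lt {N : ℕ} {x : ℕ → ℤ} {i : ℕ} (hi : i < N)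
    (h : x i + N ≤ 0) : (factMatrix N x).det = 0 :=
  Matrix.det_eq_zero_of_row_eq_zero ⟨i, hi⟩ fun k => invFact_of_neg <| by
    have := k.2
    simp only
    omega

/-- Since 1/(m-1)! = m/m! with m = x_i + k, the lowered row is x_i times the old row plus the row
with entries scaled by k. Summed over rows, the second part amounts to scaling column k by k, for
each k in turn. -/
theorem sum_det_factMatrix_sub (N : ℕ) (x : ℕ → ℤ) :
    ∑ i ∈ Finset.range N, (factMatrix N (x + Pi.single i (-1))).det =
      ((∑ i ∈ Finset.range N, (x i + i) : ℤ) : ℚ) * (factMatrix N x).det := by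
  rw [Finset.sum_range, Finset.sum_range]
  set M := factMatrix N x with hM
  have h1 : ∀ i : Fin N, (factMatrix N (x + Pi.single (i : ℕ) (-1))).det =
      (x i : ℚ) * M.det + (M.updateRow i fun k => ((k : ℕ) : ℚ) * M i k).det := by
    intro i
    rw [factMatrix_add_single, ← hM]
    have : (fun k : Fin N => invFact (x i + -1 + (k : ℕ))) =
        (x i : ℚ) • M i + fun k : Fin N => ((k : ℕ) : ℚ) * M i k := by
      ext k
      rw [show x i + -1 + ((k : ℕ) : ℤ) = x i + (k : ℕ) - 1 by ring, invFact_sub_one]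
      simp [hM, factMatrix]
      ring
    rw [this, Matrix.det_updateRow_add, Matrix.det_updateRow_smul, Matrix.updateRow_eq_self]
  rw [Finset.sum_congr rfl fun i _ => h1 i, Finset.sum_add_distrib,
    sum_det_updateRow_eq_sum_det_updateCol M fun i k => ((k : ℕ) : ℚ) * M i k]
  have h2 : ∀ j : Fin N, (M.updateCol j fun i => ((j : ℕ) : ℚ) * M i j).det = (j : ℕ) * M.det := by
    intro j
    rw [show (fun i => ((j : ℕ) : ℚ) * M i j) = ((j : ℕ) : ℚ) • (fun i => M i j) from rfl,
      Matrix.det_updateCol_smul, Matrix.updateCol_eq_self]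
  simp only [h2]
  rw [← Finset.sum_mul, ← Finset.sum_mul, ← add_mul, ← Finset.sum_add_distrib]
  push_cast
  rfl

/-- Raising x_i shifts row i by one column. Converted to columns, the sum replaces column j by the
next one, which repeats a column unless j is the last. -/
theorem sum_det_factMatrix_add (N : ℕ) (x : ℕ → ℤ) (hx : x N = -N) :
    ∑ i ∈ Finset.range (N + 1), (factMatrix (N + 1) (x + Pi.single i 1)).det =
      (factMatrix (N + 1) x).det := by
  rw [Finset.sum_range]
  set M := factMatrix (N + 1) x with hM
  have h1 : ∀ i : Fin (N + 1), (factMatrix (N + 1) (x + Pi.single (i : ℕ) 1)).det =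
      (M.updateRow i fun k => invFact (x i + 1 + (k : ℕ))).det := by
    intro i
    rw [factMatrix_add_single, ← hM]
  rw [Finset.sum_congr rfl fun i _ => h1 i, sum_det_updateRow_eq_sum_det_updateCol M
    fun i k => invFact (x i + 1 + (k : ℕ))]
  rw [Finset.sum_eq_single (Fin.last N)]
  · rw [← sub_eq_zero]
    conv_lhs => enter [2]; rw [← Matrix.updateCol_eq_self M (Fin.last N)]
    rw [sub_eq_add_neg, ← neg_one_mul, ← Matrix.det_updateCol_smul, ← Matrix.det_updateCol_add]
    -- By `hx` the last row is (0, …, 0, 1), and its corner stays 1 after the shift because 0! = 1!;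
    -- so the last row of the difference vanishes.
    refine Matrix.det_eq_zero_of_row_eq_zero (Fin.last N) fun k => ?_
    rw [Matrix.updateCol_apply]
    split_ifs with h
    · simp only [Pi.add_apply, Pi.smul_apply, hM, factMatrix, Matrix.of_apply, Fin.val_last, hx,
        smul_eq_mul, neg_add_cancel, neg_add_cancel_comm]
      simp [invFact]
    · have := Fin.val_lt_last h
      simp only [hM, factMatrix, Matrix.of_apply, Fin.val_last, hx]
      exact invFact_of_neg (by omega)
  · intro j _ hj
    have hlt := Fin.val_lt_last hj
    refine Matrix.det_zero_of_column_eq (i := j) (j := ⟨j + 1, by omega⟩)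
      (fun h => by simpa using congrArg Fin.val h) fun i => ?_
    rw [Matrix.updateCol_self, Matrix.updateCol_ne (fun h => by simpa using congrArg Fin.val h)]
    simp only [hM, factMatrix, Matrix.of_apply]
    congr 1
    push_cast
    ring
  · simp

theorem det_factMatrix_neg (N : ℕ) : (factMatrix N fun i => -(i : ℤ)).det = 1 := by
  rw [Matrix.det_of_isUpperTriangular]
  · simp [factMatrix, invFact_zero]
  · intro i j hij
    have hij : (j : ℕ) < i := hij
    exact invFact_of_neg (by simp only; omega)

end InvFact

/-! ### Adding and removing a cell of a Young diagram -/

section Diagrams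

/-- The numbers `μ_i - i`, with rows counted from zero. -/
def shiftedRows (μ : YoungDiagram) (i : ℕ) : ℤ := (μ.rowLen i : ℤ) - i

/-- The Young diagrams with `n` cells. -/
def diagramsOfCard (n : ℕ) : Finset YoungDiagram := (finite_card_eq n).toFinset

theorem mem_diagramsOfCard {n : ℕ} {μ : YoungDiagram} : μ ∈ diagramsOfCard n ↔ μ.card = n := by
  simp [diagramsOfCard]

theorem rowLen_eq_zero {μ : YoungDiagram} {i : ℕ} (h : μ.colLen 0 ≤ i) : μ.rowLen i = 0 := by
  by_contra h0
  have := YoungDiagram.mem_iff_lt_colLen.mp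
    (YoungDiagram.mem_iff_lt_rowLen.mpr (Nat.pos_of_ne_zero h0))
  omega

theorem rowLen_pos {μ : YoungDiagram} {i : ℕ} (h : i < μ.colLen 0) : 0 < μ.rowLen i :=
  YoungDiagram.mem_iff_lt_rowLen.mp (YoungDiagram.mem_iff_lt_colLen.mpr h)

theorem sum_rowLen_eq_card {μ : YoungDiagram} {N : ℕ} (h : μ.colLen 0 ≤ N) :
    ∑ i ∈ Finset.range N, μ.rowLen i = μ.card := by
  rw [card_eq_sum_rowLen, Fin.sum_univ_eq_sum_range fun i => μ.rowLen i]
  symm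
  refine Finset.sum_subset (Finset.range_subset_range.mpr h) fun i _ hi => rowLen_eq_zero ?_
  simpa using hi

theorem colLen_le_card (μ : YoungDiagram) (j : ℕ) : μ.colLen j ≤ μ.card := by
  rw [YoungDiagram.colLen_eq_card]
  exact Finset.card_le_card (Finset.filter_subset _ _)

theorem colLen_mono {ν μ : YoungDiagram} (h : ν ≤ μ) (j : ℕ) : ν.colLen j ≤ μ.colLen j := by
  by_contra! hlt
  have := YoungDiagram.mem_iff_lt_colLen.mp (h (YoungDiagram.mem_iff_lt_colLen.mpr hlt))
  exact this.false

theorem exists_cells_eq_insert {ν μ : YoungDiagram} (h : ν ≤ μ) (hc : μ.card = ν.card + 1) :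
    ∃ w, w ∉ ν.cells ∧ μ.cells = insert w ν.cells := by
  have hs : ν.cells ⊆ μ.cells := YoungDiagram.cells_subset_iff.mpr h
  obtain ⟨w, hw⟩ := Finset.card_eq_one.mp (show (μ.cells \ ν.cells).card = 1 by
    rw [Finset.card_sdiff_of_subset hs]
    have : μ.cells.card = ν.cells.card + 1 := hc
    omega)
  refine ⟨w, ?_, ?_⟩
  · have := Finset.mem_singleton_self w
    rw [← hw, Finset.mem_sdiff] at this
    exact this.2
  · rw [Finset.insert_eq, ← hw, Finset.sdiff_union_of_subset hs]

/-- A diagram with one more cell has one row that is longer by one. -/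
theorem exists_shiftedRows_eq {ν μ : YoungDiagram} (h : ν ≤ μ) (hc : μ.card = ν.card + 1) :
    ∃ i < μ.colLen 0, shiftedRows μ = shiftedRows ν + Pi.single i 1 := by
  obtain ⟨⟨i, j⟩, hw, hμ⟩ := exists_cells_eq_insert h hc
  have key : ∀ a b, b < μ.rowLen a ↔ (a = i ∧ b = j) ∨ b < ν.rowLen a := by
    intro a b
    rw [← YoungDiagram.mem_iff_lt_rowLen, ← YoungDiagram.mem_iff_lt_rowLen,
      ← YoungDiagram.mem_cells, ← YoungDiagram.mem_cells, hμ, Finset.mem_insert, Prod.mk.injEq]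
  rw [YoungDiagram.mem_cells, YoungDiagram.mem_iff_lt_rowLen] at hw
  refine ⟨i, ?_, ?_⟩
  · rw [← YoungDiagram.mem_iff_lt_colLen, YoungDiagram.mem_iff_lt_rowLen]
    exact Nat.pos_of_ne_zero fun h0 => by
      have := (key i j).mpr (Or.inl ⟨rfl, rfl⟩)
      omega
  · ext a
    simp only [shiftedRows, Pi.add_apply]
    by_cases ha : a = i
    · subst ha
      -- These three instances force the lengths of row a to be j in ν and j + 1 in μ.
      have h1 := key a j
      have h2 := key a (ν.rowLen a)
      have h3 := key a (ν.rowLen a + 1)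
      simp only [true_and, true_or, iff_true, lt_irrefl, or_false] at h1 h2 h3
      rw [Pi.single_eq_same]
      omega
    · have h1 := key a (ν.rowLen a)
      have h2 := key a (μ.rowLen a)
      simp only [ha, false_and, false_or, lt_irrefl, iff_false, false_iff] at h1 h2
      rw [Pi.single_eq_of_ne ha]
      omega

theorem exists_remove_cell {μ : YoungDiagram} {i : ℕ} (hi : μ.rowLen (i + 1) < μ.rowLen i) :
    ∃ ν ≤ μ, μ.card = ν.card + 1 ∧ shiftedRows μ = shiftedRows ν + Pi.single i 1 := by
  have hmem : (i, μ.rowLen i - 1) ∈ μ.cells := by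
    rw [YoungDiagram.mem_cells, YoungDiagram.mem_iff_lt_rowLen]; omega
  let ν : YoungDiagram := ⟨μ.cells.erase (i, μ.rowLen i - 1), by
    rintro ⟨a, b⟩ ⟨a', b'⟩ hle hab
    rw [Finset.mem_coe, Finset.mem_erase] at hab ⊢
    obtain ⟨h1, h2⟩ := Prod.mk_le_mk.mp hle
    refine ⟨fun heq => hab.1 ?_, μ.up_left_mem h1 h2 hab.2⟩
    obtain ⟨rfl, rfl⟩ := Prod.mk.inj heq
    have h3 : b < μ.rowLen a := YoungDiagram.mem_iff_lt_rowLen.mp hab.2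
    rcases h1.eq_or_lt with rfl | h1
    · exact Prod.ext rfl (show b = _ by omega)
    · have := μ.rowLen_anti (a' + 1) a h1
      omega⟩
  have hle : ν ≤ μ := YoungDiagram.cells_subset_iff.mp (Finset.erase_subset _ _)
  have hc : μ.card = ν.card + 1 := (Finset.card_erase_add_one hmem).symm
  refine ⟨ν, hle, hc, ?_⟩
  obtain ⟨k, -, hk⟩ := exists_shiftedRows_eq hle hc
  suffices k = i by rwa [this] at hk
  -- If another row had changed, row i of ν would keep its length and still contain the erased cell.
  by_contra hne
  have h1 := congrFun hk i
  rw [Pi.add_apply, Pi.single_eq_of_ne (Ne.symm hne), add_zero] at h1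
  have h2 : (i, μ.rowLen i - 1) ∈ ν.cells := by
    rw [YoungDiagram.mem_cells, YoungDiagram.mem_iff_lt_rowLen]
    simp only [shiftedRows] at h1
    omega
  exact Finset.notMem_erase _ _ h2

theorem exists_add_cell {ν : YoungDiagram} {i : ℕ} (hi : ∀ k < i, ν.rowLen i < ν.rowLen k) :
    ∃ μ, ν ≤ μ ∧ μ.card = ν.card + 1 ∧ shiftedRows μ = shiftedRows ν + Pi.single i 1 := by
  have hmem : (i, ν.rowLen i) ∉ ν.cells := by
    rw [YoungDiagram.mem_cells, YoungDiagram.mem_iff_lt_rowLen]; omega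
  let μ : YoungDiagram := ⟨insert (i, ν.rowLen i) ν.cells, by
    rintro ⟨a, b⟩ ⟨a', b'⟩ hle hab
    rw [Finset.mem_coe, Finset.mem_insert] at hab ⊢
    obtain ⟨h1, h2⟩ := Prod.mk_le_mk.mp hle
    rcases hab with hab | hab
    · obtain ⟨rfl, rfl⟩ := Prod.mk.inj hab
      rw [YoungDiagram.mem_cells, YoungDiagram.mem_iff_lt_rowLen]
      rcases h1.eq_or_lt with rfl | h1
      · rcases h2.eq_or_lt with rfl | h2
        · exact Or.inl rfl
        · exact Or.inr h2
      · exact Or.inr (h2.trans_lt (hi _ h1))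
    · exact Or.inr (ν.up_left_mem h1 h2 hab)⟩
  have hle : ν ≤ μ := YoungDiagram.cells_subset_iff.mp (Finset.subset_insert _ _)
  have hc : μ.card = ν.card + 1 := Finset.card_insert_of_notMem hmem
  refine ⟨μ, hle, hc, ?_⟩
  obtain ⟨k, -, hk⟩ := exists_shiftedRows_eq hle hc
  suffices k = i by rwa [this] at hk
  by_contra hne
  have h1 := congrFun hk i
  rw [Pi.add_apply, Pi.single_eq_of_ne (Ne.symm hne), add_zero] at h1
  have h2 : (i, ν.rowLen i) ∈ μ.cells := Finset.mem_insert_self _ _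
  rw [YoungDiagram.mem_cells, YoungDiagram.mem_iff_lt_rowLen] at h2
  simp only [shiftedRows] at h1
  omega

theorem shiftedRows_injective : Function.Injective shiftedRows := by
  intro μ ν h
  ext ⟨i, j⟩
  have := congrFun h i
  simp only [shiftedRows] at this
  rw [YoungDiagram.mem_cells, YoungDiagram.mem_cells, YoungDiagram.mem_iff_lt_rowLen,
    YoungDiagram.mem_iff_lt_rowLen]
  omega

theorem pi_single_one_injective : Function.Injective fun i : ℕ => (Pi.single i 1 : ℕ → ℤ) := by
  intro i j h
  by_contra hne
  have h := congrFun h i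
  simp only [Pi.single_eq_same, Pi.single_eq_of_ne hne] at h
  exact one_ne_zero h

-- The terms of `sum_det_factMatrix_sub` at rows without a removable cell vanish, and the factor ∑
-- (x_i + i) is |μ|.
open Classical in
theorem sum_det_factMatrix_remove {n N : ℕ} {μ : YoungDiagram} (hμ : μ.card = n + 1)
    (hN : μ.colLen 0 ≤ N) :
    ∑ ν ∈ diagramsOfCard n with ν ≤ μ, (factMatrix N (shiftedRows ν)).det =
      (n + 1) * (factMatrix N (shiftedRows μ)).det := by
  have hsum : ∑ i ∈ Finset.range N, (shiftedRows μ i + i) = n + 1 := by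
    simp only [shiftedRows, sub_add_cancel]
    rw [← Nat.cast_sum, sum_rowLen_eq_card hN, hμ]
    push_cast
    rfl
  have hex : ∀ ν : YoungDiagram, ∃ i, ν ∈ (diagramsOfCard n).filter (· ≤ μ) →
      i < N ∧ shiftedRows μ = shiftedRows ν + Pi.single i 1 := by
    intro ν
    by_cases h : ν ∈ (diagramsOfCard n).filter (· ≤ μ)
    · rw [Finset.mem_filter, mem_diagramsOfCard] at h
      obtain ⟨i, hi, hi'⟩ := exists_shiftedRows_eq h.2 (by rw [hμ, h.1])
      exact ⟨i, fun _ => ⟨hi.trans_le hN, hi'⟩⟩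
    · exact ⟨0, fun h' => absurd h' h⟩
  choose e he using hex
  have hdown := sum_det_factMatrix_sub N (shiftedRows μ)
  rw [hsum] at hdown
  push_cast at hdown
  rw [← hdown]
  refine Finset.sum_of_injOn e ?_ ?_ ?_ ?_
  · intro ν hν ν' hν' h
    have h1 := (he ν hν).2
    rw [(he ν' hν').2, h] at h1
    exact (shiftedRows_injective (add_right_cancel h1)).symm
  · intro ν hν
    simpa using (he ν hν).1
  · intro i hi hne
    rw [Finset.mem_range] at hi
    by_cases hr : μ.rowLen (i + 1) < μ.rowLen i
    · obtain ⟨ν, hle, hc, hν⟩ := exists_remove_cell hr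
      have hmem : ν ∈ (diagramsOfCard n).filter (· ≤ μ) := by
        rw [Finset.mem_filter, mem_diagramsOfCard]
        exact ⟨by omega, hle⟩
      refine absurd ⟨ν, hmem, ?_⟩ hne
      have h1 := (he ν hmem).2
      rw [hν] at h1
      exact (pi_single_one_injective (add_left_cancel h1)).symm
    · have heq : μ.rowLen (i + 1) = μ.rowLen i :=
        le_antisymm (μ.rowLen_anti i (i + 1) (Nat.le_succ i)) (not_lt.mp hr)
      rcases Nat.lt_or_ge (i + 1) N with hi1 | hi1
      · refine det_factMatrix_eq_zero_of_eq hi hi1 (Nat.succ_ne_self i).symm ?_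
        rw [Pi.add_apply, Pi.add_apply, Pi.single_eq_same, Pi.single_eq_of_ne (Nat.succ_ne_self i)]
        simp only [shiftedRows, heq]
        push_cast
        ring
      -- Here i is the last row and is empty in μ; lowering it makes every factorial argument in it
      -- negative.
      · refine det_factMatrix_eq_zero_of_lt hi ?_
        have h0 : μ.rowLen (i + 1) = 0 := rowLen_eq_zero (hN.trans hi1)
        rw [Pi.add_apply, Pi.single_eq_same]
        simp only [shiftedRows]
        omega
  · intro ν hν
    rw [(he ν hν).2, add_assoc, ← Pi.single_add]
    simp

-- The terms of `sum_det_factMatrix_add` at rows where no cell can be added vanish. The strict bound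
-- on N leaves the last row of ν empty, as that identity requires.
open Classical in
theorem sum_det_factMatrix_insert {n N : ℕ} {ν : YoungDiagram} (hν : ν.card = n) (hN : n < N) :
    ∑ μ ∈ diagramsOfCard (n + 1) with ν ≤ μ, (factMatrix N (shiftedRows μ)).det =
      (factMatrix N (shiftedRows ν)).det := by
  obtain ⟨N, rfl⟩ : ∃ M, N = M + 1 := ⟨N - 1, by omega⟩
  have hcol : ν.colLen 0 ≤ N := (colLen_le_card ν 0).trans (by omega)
  have hex : ∀ μ : YoungDiagram, ∃ i, μ ∈ (diagramsOfCard (n + 1)).filter (ν ≤ ·) →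
      i < N + 1 ∧ shiftedRows μ = shiftedRows ν + Pi.single i 1 := by
    intro μ
    by_cases h : μ ∈ (diagramsOfCard (n + 1)).filter (ν ≤ ·)
    · rw [Finset.mem_filter, mem_diagramsOfCard] at h
      obtain ⟨i, hi, hi'⟩ := exists_shiftedRows_eq h.2 (by rw [hν, h.1])
      have := colLen_le_card μ 0
      exact ⟨i, fun _ => ⟨by omega, hi'⟩⟩
    · exact ⟨0, fun h' => absurd h' h⟩
  choose e he using hex
  rw [← sum_det_factMatrix_add N (shiftedRows ν) (by simp [shiftedRows, rowLen_eq_zero hcol])]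
  refine Finset.sum_of_injOn e ?_ ?_ ?_ ?_
  · intro μ hμ μ' hμ' h
    apply shiftedRows_injective
    rw [(he μ hμ).2, (he μ' hμ').2, h]
  · intro μ hμ
    simpa using (he μ hμ).1
  · intro i hi hne
    rw [Finset.mem_range] at hi
    by_cases hr : ∀ k < i, ν.rowLen i < ν.rowLen k
    · obtain ⟨μ, hle, hc, hμ⟩ := exists_add_cell hr
      have hmem : μ ∈ (diagramsOfCard (n + 1)).filter (ν ≤ ·) := by
        rw [Finset.mem_filter, mem_diagramsOfCard]
        exact ⟨by omega, hle⟩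
      refine absurd ⟨μ, hmem, ?_⟩ hne
      have h1 := (he μ hmem).2
      rw [hμ] at h1
      exact (pi_single_one_injective (add_left_cancel h1)).symm
    · push Not at hr
      obtain ⟨k, hk, hle⟩ := hr
      have h1 := ν.rowLen_anti k (i - 1) (by omega)
      have h2 := ν.rowLen_anti (i - 1) i (by omega)
      -- Rows i - 1 and i of ν have equal length, so raising row i makes two rows of the matrix
      -- equal.
      refine det_factMatrix_eq_zero_of_eq hi (j := i - 1) (by omega) (by omega) ?_
      rw [Pi.add_apply, Pi.add_apply, Pi.single_eq_same, Pi.single_eq_of_ne (by omega)]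
      simp only [shiftedRows]
      omega
  · intro μ hμ
    rw [(he μ hμ).2]

end Diagrams

/-! ### Counting standard fillings and the dimension of the Specht module -/

section Count

open Classical in
/-- The standard fillings of the diagram `μ` with `n` entries. -/
def standardFillings (n : ℕ) (μ : YoungDiagram) : Finset (Fin n → ℕ × ℕ) :=
  (Fintype.piFinset fun _ => μ.cells).filter fun T => IsStandard T ∧ Set.range T = μ.cells

theorem mem_standardFillings {n : ℕ} {μ : YoungDiagram} {T : Fin n → ℕ × ℕ} :
    T ∈ standardFillings n μ ↔ IsStandard T ∧ Set.range T = μ.cells := by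
  classical
  rw [standardFillings, Finset.mem_filter, Fintype.mem_piFinset, and_iff_right_of_imp]
  intro h i
  rw [← Finset.mem_coe, ← h.2]
  exact Set.mem_range_self i

theorem eq_of_mem_standardFillings {n : ℕ} {μ ν : YoungDiagram} {T : Fin n → ℕ × ℕ}
    (hμ : T ∈ standardFillings n μ) (hν : T ∈ standardFillings n ν) : μ = ν := by
  rw [mem_standardFillings] at hμ hν
  exact YoungDiagram.ext (Finset.coe_injective (hμ.2.symm.trans hν.2))

theorem IsStandard.init {n : ℕ} {T : Fin (n + 1) → ℕ × ℕ} (hT : IsStandard T) :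
    IsStandard (Fin.init T) where
  injective i j h := Fin.castSucc_injective n (hT.injective h)
  exists_le k w hw := by
    obtain ⟨j, hj, hjw⟩ := hT.exists_le k.castSucc w hw
    exact ⟨j.castLT (lt_of_le_of_lt hj k.2), hj, hjw⟩

theorem IsStandard.exists_mem_standardFillings {n : ℕ} {T : Fin n → ℕ × ℕ} (hT : IsStandard T) :
    ∃ ν, T ∈ standardFillings n ν ∧ ν.card = n := by
  let ν : YoungDiagram := ⟨Finset.univ.image T, by
    intro w w' hle hw
    simp only [Finset.coe_image, Finset.coe_univ, Set.image_univ, Set.mem_range] at hw ⊢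
    obtain ⟨k, rfl⟩ := hw
    obtain ⟨j, -, hj⟩ := hT.exists_le k w' hle
    exact ⟨j, hj⟩⟩
  refine ⟨ν, mem_standardFillings.mpr ⟨hT, by simp [ν]⟩, ?_⟩
  exact (Finset.card_image_of_injective _ hT.injective).trans (Finset.card_fin n)

open Classical in
/-- The branching rule for the numbers of standard fillings. -/
theorem card_standardFillings_succ {n : ℕ} {μ : YoungDiagram} (hμ : μ.card = n + 1) :
    (standardFillings (n + 1) μ).card =
      ∑ ν ∈ diagramsOfCard n with ν ≤ μ, (standardFillings n ν).card := by
  rw [← Finset.card_biUnion]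
  · refine Finset.card_bij (fun T _ => Fin.init T) ?_ ?_ ?_
    · intro T hT
      rw [mem_standardFillings] at hT
      obtain ⟨ν, hν, hc⟩ := hT.1.init.exists_mem_standardFillings
      refine Finset.mem_biUnion.mpr ⟨ν, ?_, hν⟩
      rw [Finset.mem_filter, mem_diagramsOfCard]
      refine ⟨hc, YoungDiagram.cells_subset_iff.mp ?_⟩
      rw [← Finset.coe_subset, ← hT.2, ← (mem_standardFillings.mp hν).2]
      rintro _ ⟨i, rfl⟩
      exact ⟨i.castSucc, rfl⟩
    · intro T hT T' hT' h
      rw [mem_standardFillings] at hT hT'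
      have hlast : T (Fin.last n) = T' (Fin.last n) := by
        have hmem : T (Fin.last n) ∈ Set.range T' := by
          rw [hT'.2, ← hT.2]; exact Set.mem_range_self _
        obtain ⟨j, hj⟩ := hmem
        induction j using Fin.lastCases with
        | last => exact hj.symm
        | cast j =>
          have h1 : T j.castSucc = T' j.castSucc := congrFun h j
          rw [← h1] at hj
          exact absurd (hT.1.injective hj) (Fin.castSucc_lt_last j).ne
      rw [← Fin.snoc_init_self T, ← Fin.snoc_init_self T', h, hlast]
    · intro T' hT'
      obtain ⟨ν, hν, hT'⟩ := Finset.mem_biUnion.mp hT'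
      rw [Finset.mem_filter, mem_diagramsOfCard] at hν
      obtain ⟨w, hw, hμν⟩ := exists_cells_eq_insert hν.2 (by rw [hμ, hν.1])
      rw [mem_standardFillings] at hT'
      have hne : ∀ i, T' i ≠ w := fun i h => hw <| by
        rw [← Finset.mem_coe, ← hT'.2, ← h]; exact Set.mem_range_self i
      refine ⟨Fin.snoc T' w, ?_, Fin.init_snoc _ _⟩
      rw [mem_standardFillings]
      refine ⟨⟨?_, ?_⟩, ?_⟩
      · rw [Fin.snoc_injective_iff]
        exact ⟨hT'.1.injective, fun ⟨i, hi⟩ => hne i hi⟩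
      · intro k v hv
        induction k using Fin.lastCases with
        | last =>
          rw [Fin.snoc_last] at hv
          have hvμ : v ∈ μ.cells :=
            μ.isLowerSet hv (by rw [hμν]; exact Finset.mem_insert_self _ _)
          rw [hμν, Finset.mem_insert, ← Finset.mem_coe, ← hT'.2] at hvμ
          rcases hvμ with rfl | ⟨j, rfl⟩
          · exact ⟨Fin.last n, le_rfl, Fin.snoc_last _ _⟩
          · exact ⟨j.castSucc, Fin.le_last _, Fin.snoc_castSucc _ _ _⟩
        | cast k =>
          rw [Fin.snoc_castSucc] at hv
          obtain ⟨j, hj, rfl⟩ := hT'.1.exists_le k v hv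
          exact ⟨j.castSucc, Fin.castSucc_le_castSucc_iff.mpr hj, Fin.snoc_castSucc _ _ _⟩
      · rw [Fin.range_snoc, hT'.2, hμν, Finset.coe_insert]
  · intro ν _ ν' _ hne
    rw [Function.onFun, Finset.disjoint_left]
    exact fun T hT hT' => hne (eq_of_mem_standardFillings hT hT')

theorem card_standardFillings_zero {μ : YoungDiagram} (hμ : μ.card = 0) :
    (standardFillings 0 μ).card = 1 := by
  rw [Finset.card_eq_one]
  refine ⟨Fin.elim0, ?_⟩
  ext T
  rw [Finset.mem_singleton, mem_standardFillings]
  refine iff_of_true ⟨⟨fun i => i.elim0, fun k => k.elim0⟩, ?_⟩ (Subsingleton.elim _ _)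
  rw [Finset.card_eq_zero.mp hμ, Set.range_eq_empty, Finset.coe_empty]

/-- Frobenius' determinantal formula for the number of standard fillings. -/
theorem card_standardFillings {n N : ℕ} {μ : YoungDiagram} (hμ : μ.card = n)
    (hN : μ.colLen 0 ≤ N) :
    ((standardFillings n μ).card : ℚ) = n.factorial * (factMatrix N (shiftedRows μ)).det := by
  classical
  induction n generalizing μ with
  | zero =>
    have h0 : shiftedRows μ = fun i : ℕ => -(i : ℤ) := by
      ext i
      have : μ.colLen 0 ≤ i := (colLen_le_card μ 0).trans (by omega)
      simp [shiftedRows, rowLen_eq_zero this]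
    rw [card_standardFillings_zero hμ, h0, det_factMatrix_neg]
    simp
  | succ n ih =>
    rw [card_standardFillings_succ hμ]
    push_cast
    rw [Finset.sum_congr rfl (g := fun ν => (n.factorial : ℚ) *
      (factMatrix N (shiftedRows ν)).det), ← Finset.mul_sum, sum_det_factMatrix_remove hμ hN,
      Nat.factorial_succ]
    · push_cast
      ring
    · intro ν hν
      rw [Finset.mem_filter, mem_diagramsOfCard] at hν
      exact ih hν.1 ((colLen_mono hν.2 0).trans hN)

theorem card_standardFillings_pos {n : ℕ} {μ : YoungDiagram} (hμ : μ.card = n) :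
    0 < (standardFillings n μ).card := by
  classical
  induction n generalizing μ with
  | zero => rw [card_standardFillings_zero hμ]; exact one_pos
  | succ n ih =>
    have hcol : 0 < μ.colLen 0 := by
      by_contra h
      have h1 := sum_rowLen_eq_card (μ := μ) (N := 0) (by omega)
      simp only [Finset.range_zero, Finset.sum_empty] at h1
      omega
    -- The last nonempty row always ends in a removable cell.
    have hlast : μ.rowLen (μ.colLen 0 - 1 + 1) < μ.rowLen (μ.colLen 0 - 1) := by
      rw [rowLen_eq_zero (by omega)]
      exact rowLen_pos (by omega)
    obtain ⟨ν, hle, hc, -⟩ := exists_remove_cell hlast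
    rw [card_standardFillings_succ hμ]
    refine (ih (show ν.card = n by omega)).trans_le (Finset.single_le_sum
      (f := fun ν => (standardFillings n ν).card) (fun _ _ => Nat.zero_le _) ?_)
    rw [Finset.mem_filter, mem_diagramsOfCard]
    exact ⟨by omega, hle⟩

open Classical in
theorem sum_card_standardFillings_succ {n : ℕ} {ν : YoungDiagram} (hν : ν.card = n) :
    ∑ μ ∈ diagramsOfCard (n + 1) with ν ≤ μ, (standardFillings (n + 1) μ).card =
      (n + 1) * (standardFillings n ν).card := by
  have hcol := colLen_le_card ν 0
  rw [← Nat.cast_inj (R := ℚ)]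
  push_cast
  -- Size n + 1 is enough for every μ and exceeds the number of rows of ν.
  rw [card_standardFillings hν (N := n + 1) (by omega), ← mul_assoc,
    ← sum_det_factMatrix_insert hν (Nat.lt_succ_self n), Finset.mul_sum]
  refine Finset.sum_congr rfl fun μ hμ => ?_
  rw [Finset.mem_filter, mem_diagramsOfCard] at hμ
  have := colLen_le_card μ 0
  rw [card_standardFillings hμ.1 (N := n + 1) (by omega), Nat.factorial_succ]
  push_cast
  ring

/-- Expand one factor f_μ by removing a cell, exchange the sums, and collect the f_μ above each ν to
(n + 1) f_ν. -/
theorem sum_card_standardFillings_sq (n : ℕ) :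
    ∑ μ ∈ diagramsOfCard n, (standardFillings n μ).card ^ 2 = n.factorial := by
  classical
  induction n with
  | zero =>
    rw [Finset.sum_congr rfl (g := fun _ => 1)]
    · rw [Finset.sum_const, smul_eq_mul, mul_one, Nat.factorial_zero, Finset.card_eq_one]
      refine ⟨⊥, ?_⟩
      ext μ
      rw [mem_diagramsOfCard, Finset.mem_singleton, YoungDiagram.card, Finset.card_eq_zero]
      exact ⟨fun h => YoungDiagram.ext (by rw [h, YoungDiagram.cells_bot]), fun h => by
        rw [h, YoungDiagram.cells_bot]⟩
    · intro μ hμ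
      rw [card_standardFillings_zero (mem_diagramsOfCard.mp hμ), one_pow]
  | succ n ih =>
    have h1 : ∀ μ ∈ diagramsOfCard (n + 1), (standardFillings (n + 1) μ).card ^ 2 =
        ∑ ν ∈ diagramsOfCard n, if ν ≤ μ then
          (standardFillings n ν).card * (standardFillings (n + 1) μ).card else 0 := by
      intro μ hμ
      rw [sq]
      conv_lhs => enter [1]; rw [card_standardFillings_succ (mem_diagramsOfCard.mp hμ)]
      rw [Finset.sum_mul, Finset.sum_filter]
    rw [Finset.sum_congr rfl h1, Finset.sum_comm, Nat.factorial_succ, ← ih, Finset.mul_sum]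
    refine Finset.sum_congr rfl fun ν hν => ?_
    rw [← Finset.sum_filter, ← Finset.mul_sum,
      sum_card_standardFillings_succ (mem_diagramsOfCard.mp hν)]
    ring

theorem card_standardFillings_le_spechtDim {n : ℕ} {μ : YoungDiagram} (hμ : μ.card = n) :
    (standardFillings n μ).card ≤ spechtDim μ := by
  obtain ⟨T, hT⟩ := Finset.card_pos.mp (card_standardFillings_pos hμ)
  rw [mem_standardFillings] at hT
  rw [← symmetrizerRank_eq_spechtDim hT.1.injective hT.2]
  refine card_le_symmetrizerRank hT.1.injective _ (fun S hS => (mem_standardFillings.mp hS).1)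
    fun S hS => (mem_standardFillings.mp hS).2.trans hT.2.symm

theorem sum_card_standardFillings_mul_spechtDim_le (n : ℕ) :
    ∑ μ ∈ diagramsOfCard n, (standardFillings n μ).card * spechtDim μ ≤ n.factorial := by
  classical
  refine le_trans (le_of_eq ?_) (sum_symmetrizerRank_le
    ((diagramsOfCard n).biUnion (standardFillings n)) ?_)
  · rw [Finset.sum_biUnion]
    · refine Finset.sum_congr rfl fun μ _ => ?_
      rw [Finset.sum_congr rfl (g := fun _ => spechtDim μ), Finset.sum_const, smul_eq_mul]
      intro T hT
      rw [mem_standardFillings] at hT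
      exact symmetrizerRank_eq_spechtDim hT.1.injective hT.2
    · intro ν _ ν' _ hne
      rw [Function.onFun, Finset.disjoint_left]
      exact fun T hT hT' => hne (eq_of_mem_standardFillings hT hT')
  · intro T hT
    obtain ⟨μ, -, hT⟩ := Finset.mem_biUnion.mp hT
    exact (mem_standardFillings.mp hT).1

/-- The dimension of the Specht module is the number of standard fillings. -/
theorem spechtDim_eq_card_standardFillings {n : ℕ} {μ : YoungDiagram} (hμ : μ.card = n) :
    spechtDim μ = (standardFillings n μ).card := by
  have hle : ∀ ν ∈ diagramsOfCard n, (standardFillings n ν).card ^ 2 ≤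
      (standardFillings n ν).card * spechtDim ν := fun ν hν => by
    rw [sq]
    exact Nat.mul_le_mul_left _ (card_standardFillings_le_spechtDim (mem_diagramsOfCard.mp hν))
  have heq : ∑ ν ∈ diagramsOfCard n, (standardFillings n ν).card ^ 2 =
      ∑ ν ∈ diagramsOfCard n, (standardFillings n ν).card * spechtDim ν :=
    le_antisymm (Finset.sum_le_sum hle) <| by
      rw [sum_card_standardFillings_sq]
      exact sum_card_standardFillings_mul_spechtDim_le n
  have h := (Finset.sum_eq_sum_iff_of_le hle).mp heq μ (mem_diagramsOfCard.mpr hμ)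
  rw [sq] at h
  exact (Nat.eq_of_mul_eq_mul_left (card_standardFillings_pos hμ) h).symm

/-- The determinantal formula for the dimension of the Specht module. -/
theorem spechtDim_div_factorial {N : ℕ} {μ : YoungDiagram} (hN : μ.colLen 0 ≤ N) :
    (spechtDim μ : ℚ) / (Nat.factorial μ.card : ℚ) = (factMatrix N (shiftedRows μ)).det := by
  rw [spechtDim_eq_card_standardFillings rfl, card_standardFillings rfl hN,
    mul_div_cancel_left₀ _ (Nat.cast_ne_zero.mpr (Nat.factorial_ne_zero _))]

end Count

/-! ### The plane of the series and its minors -/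

section Wedge

variable {R : Type*} [CommRing R]

/-- The product of the parameters `y_c` over `a < c ≤ b`. -/
def contentRange (y : ℤ → R) (a b : ℤ) : R := ∏ c ∈ Finset.Ioc a b, y c

theorem Ioc_val_add_Ioc_val {a b c : ℤ} (hab : a ≤ b) (hbc : b ≤ c) :
    (Finset.Ioc a b).val + (Finset.Ioc b c).val = (Finset.Ioc a c).val := by
  rw [← Finset.Ioc_union_Ioc_eq_Ioc hab hbc, ← Finset.disjUnion_eq_union _ _
    (Finset.disjoint_left.mpr fun x h1 h2 => by
      rw [Finset.mem_Ioc] at h1 h2; omega)]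
  rfl

/-- The contribution of the parameters to a term of a minor does not depend on the term. -/
theorem prod_contentRange_perm (y : ℤ → R) {n : ℕ} (a b : Fin n → ℤ) (σ : Equiv.Perm (Fin n))
    (h : ∀ i, a i ≤ b i) (hσ : ∀ i, a (σ i) ≤ b i) :
    ∏ i, contentRange y (a (σ i)) (b i) = ∏ i, contentRange y (a i) (b i) := by
  obtain ⟨N, hN⟩ : ∃ N, ∀ i, N ≤ a i := by
    obtain ⟨N, hN⟩ := (Set.finite_range a).bddBelow
    exact ⟨N, fun i => hN (Set.mem_range_self i)⟩
  -- Extending the intervals down to a common bound N is done with multisets of indices, which can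
  -- be cancelled, whereas the parameters need not be invertible.
  have key : ∀ τ : Equiv.Perm (Fin n), (∀ i, a (τ i) ≤ b i) →
      ∑ i, (Finset.Ioc N (a i)).val + ∑ i, (Finset.Ioc (a (τ i)) (b i)).val =
        ∑ i, (Finset.Ioc N (b i)).val := by
    intro τ hτ
    rw [← Equiv.sum_comp τ fun i => (Finset.Ioc N (a i)).val, ← Finset.sum_add_distrib]
    exact Finset.sum_congr rfl fun i _ => Ioc_val_add_Ioc_val (hN _) (hτ i)
  have hval : ∑ i, (Finset.Ioc (a (σ i)) (b i)).val = ∑ i, (Finset.Ioc (a i) (b i)).val :=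
    add_left_cancel ((key σ hσ).trans (key 1 h).symm)
  have hprod : ∀ a' : Fin n → ℤ, ∏ i, contentRange y (a' i) (b i) =
      ((∑ i, (Finset.Ioc (a' i) (b i)).val).map y).prod := by
    intro a'
    rw [← Multiset.coe_mapAddMonoidHom, map_sum, Multiset.prod_sum]
    rfl
  rw [hprod, hprod fun i => a i, hval]

/-- The contents along row i are the consecutive integers from -i to μ_i - i - 1; rows past the end
give empty products. -/
theorem contentProduct_eq_prod (y : ℤ → R) {μ : YoungDiagram} {n : ℕ} (hn : μ.colLen 0 ≤ n) :
    contentProduct y μ =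
      ∏ i : Fin n, contentRange y (-((i : ℕ) : ℤ) - 1) (shiftedRows μ i - 1) := by
  rw [contentProduct, ← Finset.prod_range fun i => contentRange y (-(i : ℤ) - 1)
    (shiftedRows μ i - 1), ← Finset.prod_fiberwise_of_maps_to (t := Finset.range n) (g := Prod.fst)]
  · refine Finset.prod_congr rfl fun i _ => ?_
    refine Finset.prod_bij (fun w _ => content w) ?_ ?_ ?_ fun _ _ => rfl
    · rintro ⟨a, j⟩ hw
      rw [Finset.mem_filter, YoungDiagram.mem_cells, YoungDiagram.mem_iff_lt_rowLen] at hw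
      obtain ⟨hw, rfl⟩ := hw
      simp only [content, shiftedRows, Finset.mem_Ioc]
      omega
    · rintro ⟨a, j⟩ hw ⟨a', j'⟩ hw' h
      obtain rfl : a = i := (Finset.mem_filter.mp hw).2
      obtain rfl : a' = a := (Finset.mem_filter.mp hw').2
      simp only [content] at h
      exact Prod.ext rfl (show j = j' by omega)
    · intro c hc
      simp only [shiftedRows, Finset.mem_Ioc] at hc
      refine ⟨(i, (c + i).toNat), ?_, ?_⟩
      · rw [Finset.mem_filter, YoungDiagram.mem_cells, YoungDiagram.mem_iff_lt_rowLen]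
        exact ⟨by omega, rfl⟩
      · simp only [content]
        omega
  · rintro ⟨i, j⟩ hw
    rw [Finset.mem_range]
    exact (YoungDiagram.mem_iff_lt_colLen.mp (μ.up_left_mem le_rfl (Nat.zero_le j) hw)).trans_le hn

variable [Algebra ℚ R]

/-- The coefficient of `z ^ m` in the Laurent series `β_{k+1}` spanning the plane of the
Orlov–Shcherbin `τ`-function. -/
def planeCoeff (y : ℤ → R) (k : ℕ) (m : ℤ) : R :=
  contentRange y (-(k : ℤ) - 1) m * algebraMap ℚ R (invFact (m + 1 + k))

/-- The Laurent series spanning the plane of the Orlov–Shcherbin `τ`-function. -/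
def planeSeries (y : ℤ → R) (k : ℕ) : LaurentSeries R :=
  HahnSeries.ofSuppBddBelow (planeCoeff y k) ⟨-(k : ℤ) - 1, by
    intro m hm
    by_contra hlt
    refine hm ?_
    rw [planeCoeff, invFact_of_neg (by omega), map_zero, mul_zero]⟩

theorem coeff_planeSeries (y : ℤ → R) (k : ℕ) (m : ℤ) :
    (planeSeries y k).coeff m = planeCoeff y k m := rfl

theorem isAdmissible_planeSeries (y : ℤ → R) : IsAdmissible (planeSeries y) := by
  refine ⟨0, fun k _ => ⟨?_, fun m hm => ?_⟩⟩
  · rw [coeff_planeSeries, planeCoeff, contentRange, Finset.Ioc_self, Finset.prod_empty,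
      show -(k : ℤ) - 1 + 1 + k = 0 by ring, invFact_zero, map_one, one_mul]
  · rw [coeff_planeSeries, planeCoeff, invFact_of_neg (by omega), map_zero, mul_zero]

theorem det_planeCoeff (y : ℤ → R) {μ : YoungDiagram} {n : ℕ} (hn : μ.colLen 0 ≤ n) :
    Matrix.det (Matrix.of fun i k : Fin n => planeCoeff y k (shiftedRows μ i - 1)) =
      contentProduct y μ * algebraMap ℚ R (factMatrix n (shiftedRows μ)).det := by
  -- After transposing, the permutation acts on the index k of β_k, that is, on the lower endpoints
  -- of the intervals.
  rw [← Matrix.det_transpose, ← Matrix.det_transpose (factMatrix _ _), Matrix.det_apply,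
    Matrix.det_apply, map_sum, Finset.mul_sum]
  refine Finset.sum_congr rfl fun σ _ => ?_
  rw [Units.smul_def, Units.smul_def, map_zsmul, mul_smul_comm]
  congr 1
  simp only [Matrix.transpose_apply, Matrix.of_apply, planeCoeff, factMatrix]
  rw [Finset.prod_mul_distrib, map_prod]
  have hcast : ∀ i : Fin n, shiftedRows μ i - 1 + 1 + ((σ i : ℕ) : ℤ) =
      shiftedRows μ i + (σ i : ℕ) := fun i => by ring
  simp only [hcast]
  -- An interval with its endpoints in the wrong order would break the rearrangement, but then the
  -- reciprocal factorial is 0 and kills the term on both sides.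
  by_cases hneg : ∃ i : Fin n, shiftedRows μ i + (σ i : ℕ) < 0
  · obtain ⟨i, hi⟩ := hneg
    have h0 : ∏ i : Fin n, algebraMap ℚ R (invFact (shiftedRows μ i + (σ i : ℕ))) = 0 :=
      Finset.prod_eq_zero (Finset.mem_univ i) (by rw [invFact_of_neg hi, map_zero])
    rw [h0, mul_zero, mul_zero]
  · push Not at hneg
    rw [contentProduct_eq_prod y hn, prod_contentRange_perm y
      (fun i : Fin n => -((i : ℕ) : ℤ) - 1) (fun i : Fin n => shiftedRows μ i - 1) σ]
    · intro i
      simp only [shiftedRows]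
      omega
    · intro i
      have := hneg i
      omega

theorem isWedgeExpansion_planeSeries (y : ℤ → R) :
    IsWedgeExpansion (planeSeries y) fun μ => contentProduct y μ *
      algebraMap ℚ R ((spechtDim μ : ℚ) / (Nat.factorial μ.card : ℚ)) := by
  intro μ
  refine ⟨μ.colLen 0, fun n hn => ?_⟩
  simp only
  rw [spechtDim_div_factorial hn, ← det_planeCoeff y hn]
  rfl

end Wedge

end KP

end

theorem theorem2p1 {R : Type*} [CommRing R] [Algebra ℚ R] (y : ℤ → R) :
    KP.IsTauFunction (KP.schurSeries fun μ : YoungDiagram =>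
      KP.contentProduct y μ *
        algebraMap ℚ R ((KP.spechtDim μ : ℚ) / (Nat.factorial μ.card : ℚ))) := by
  refine ⟨KP.planeSeries y, _, KP.isAdmissible_planeSeries y, KP.isWedgeExpansion_planeSeries y,
    ?_, rfl⟩
  -- The coordinate of the empty diagram is 1: an empty product times a determinant of size 0.
  refine (Ideal.eq_top_iff_one _).mpr (Ideal.subset_span ⟨⊥, ?_⟩)
  have h : (⊥ : YoungDiagram).colLen 0 ≤ 0 := KP.colLen_le_card _ _
  simp only
  rw [KP.spechtDim_div_factorial h, Matrix.det_isEmpty, map_one, mul_one, KP.contentProduct,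
    YoungDiagram.cells_bot, Finset.prod_empty]
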